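/- Let $n\ge 2$, let $M$ be a smooth (Hausdorff) $n$-manifold, $\nabla$ a smooth affine connection on $M$ (torsion is allowed), and $(U,x^1,\dots,x^n)$ a smooth chart of $M$. Repeated indices are summed. Put $$\Gamma^i{}_{jk}=dx^i\bigl(\nabla_{\partial/\partial x^k}\tfrac{\partial}{\partial x^j}\bigr),\qquad \mu_j=\tfrac12\bigl(\Gamma^\alpha{}_{\alpha j}-\Gamma^\alpha{}_{j\alpha}\bigr),\qquad \nu_j=-\tfrac1{2(n+1)}\bigl(\Gamma^\alpha{}_{\alpha j}+\Gamma^\alpha{}_{j\alpha}\bigr).$$ *Projective structure.* Let $\widetilde G^2=\mathrm{GL}_n(\mathbb R)\ltimes\mathbb R^{n^3}$ with $(a^i{}_j,a^i{}_{jk})(b^i{}_j,b^i{}_{jk})=(a^i{}_lb^l{}_j,\;a^i{}_lb^l{}_{jk}+a^i{}_{lm}b^l{}_jb^m{}_k)$, and let $\widetilde P^2(M)$ be the principal $\widetilde G^2$-bundle of formal $2$-frames. It has natural coordinates $(u^i,u^i{}_j,u^i{}_{jk})$ over each chart, which change under a coordinate change $\psi$ by $(u^i,u^i{}_j,u^i{}_{jk})\mapsto\bigl(\psi^i(u),\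 \partial_l\psi^i\,u^l{}_j,\ \partial_l\psi^i\,u^l{}_{jk}+\partial_l\partial_m\psi^i\,u^l{}_ju^m{}_k\bigr)$; its canonical form is $\theta^i=v^i{}_\alpha du^\alpha$, $\theta^i{}_j=v^i{}_\alpha du^\alpha{}_j-v^i{}_\alpha u^\alpha{}_{j\beta}v^\beta{}_\gamma du^\gamma$, where $(v^i{}_j)=(u^i{}_j)^{-1}$. Let $H\subset\mathrm{PGL}_{n+1}(\mathbb R)$ be the group of classes of the matrices $\begin{pmatrix}a&0\\ \xi&1\end{pmatrix}$, identified with the subgroup $H^2\subset\widetilde G^2$ of elements $\bigl(a^i{}_j,-(a^i{}_j\xi_k+\xi_ja^i{}_k)\bigr)$. The projective structure determined by $\nabla$ is the subbundle $P\subset\widetilde P^2(M)$ with group $H^2$ which over each chart is the union of the $H^2$-orbits of the frames $(x^i,\delta^i{}_j,-\Gamma^i{}_{jk}(x))$. *Normal projective connection.* Identify $\mathfrak g=\mathfrak{pgl}_{n+1}(\mathbb R)$ with $\mathbb R^n\oplus\mathfrak{gl}_n(\mathbb R)\oplus(\mathbb R^n)^*$, where $(v,B,\zeta)$ corresponds to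 the class of $\begin{pmatrix}B&v\\ \zeta&0\end{pmatrix}$ modulo scalar matrices. A normal projective connection for $P$ is a smooth $\mathfrak g$-valued $1$-form $\omega=(\omega^i,\omega^i{}_j,\omega_j)$ on $P$ such that - $\omega(A^*)=A$ for every fundamental vector field $A^*$, $A\in\mathfrak h$, and $\omega(X)\ne0$ for every tangent vector $X\neq0$; - the components $(\omega^i,\omega^i{}_j)$ of $R_h^*\omega$ and of $\mathrm{Ad}_{h^{-1}}\omega$ agree for all $h\in H^2$, and $R_h^*\omega=\mathrm{Ad}_{h^{-1}}\omega$ for all $h\in\mathrm{GL}_n(\mathbb R)\subset H^2$ (that is, $\xi=0$); - $(\omega^i,\omega^i{}_j)$ is the restriction of the canonical form $(\theta^i,\theta^i{}_j)$ to $P$; - the form $\Omega^i{}_j=d\omega^i{}_j+\omega^i{}_k\wedge\omega^k{}_j+\omega^i\wedge\omega_j-\delta^i{}_j\,\omega_k\wedge\omega^k$ can be written as $\frac12K^i{}_{jkl}\,\omega^k\wedge\omega^l$ with $K^i{}_{jlk}=-K^i{}_{jkl}$ and $K^i{}_{jil}=0$. In particular, every Cartan connection on $P$ that extends the restriction of the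 canonical form and satisfies $K^i{}_{jil}=0$ is a normal projective connection in this sense. **Proposition.** Let $\omega$ be a normal projective connection for $P$. There is a unique smooth section $\sigma\colon U\to P$ such that 1. $\sigma^*\omega^i=dx^i$, and 2. if $\sigma^*\omega^i{}_j=\Pi^i{}_{jk}\,dx^k$, then $\Pi^i{}_{ik}=\mu_k$. Moreover $\sigma$ satisfies 2'. $\Pi^i{}_{ji}=-\mu_j$, and, writing $\sigma^*\omega_j=\Pi_{jk}\,dx^k$, one has on $U$ $$\Pi^i{}_{jk}=\Gamma^i{}_{jk}+\delta^i{}_j\nu_k+\delta^i{}_k\nu_j=\Gamma^i{}_{jk}-\frac1{2(n+1)}\bigl(\delta^i{}_j(\Gamma^\alpha{}_{\alpha k}+\Gamma^\alpha{}_{k\alpha})+\delta^i{}_k(\Gamma^\alpha{}_{\alpha j}+\Gamma^\alpha{}_{j\alpha})\bigr),$$ $$\Pi_{jk}=\frac{-1}{n^2-1}\bigl(n\,R_{jk}+R_{kj}\bigr),\qquad R_{jk}=\frac{\partial\Pi^i{}_{jk}}{\partial x^i}+\frac{\partial\mu_j}{\partial x^k}-\mu_\alpha\Pi^\alpha{}_{jk}-\Pi^\alpha{}_{j\beta}\Pi^\beta{}_{\alpha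 k}.$$ Conditions 2 and 2' can be exchanged: $\sigma$ is also the unique smooth section satisfying 1 and 2'. -/

import Mathlib

open scoped Manifold ContDiff

noncomputable section

namespace ProjConn

/-! ## Groups of formal 2-jets -/

/-- The model space `ℝⁿ` of an `n`-manifold. -/
abbrev Vec (n : ℕ) := EuclideanSpace ℝ (Fin n)

/-- Arrays `(a^i_j)`; written `a i j`. -/
abbrev Sq (n : ℕ) := Fin n → Fin n → ℝ

/-- Arrays `(a^i_{jk})`; written `a i j k`. -/
abbrev Cube (n : ℕ) := Fin n → Fin n → Fin n → ℝ

/-- The Kronecker symbol `δ^i_j`. -/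
def delta {n : ℕ} (i j : Fin n) : ℝ := if i = j then 1 else 0

/-- Invertibility of `(a^i_j)`. -/
def Inv {n : ℕ} (a : Sq n) : Prop := (Matrix.of a).det ≠ 0

/-- The inverse array `(v^i_j) = (a^i_j)⁻¹`. -/
def inv {n : ℕ} (a : Sq n) : Sq n := fun i j => (Matrix.of a)⁻¹ i j

/-- The multiplication law of formal 2-jets `(a^i_j, a^i_{jk})`:
`(a, a₂)(b, b₂) = (a^i_l b^l_j, a^i_l b^l_{jk} + a^i_{lm} b^l_j b^m_k)`. The group `G̃²` consists of
the pairs whose first entry is invertible; no symmetry in `j, k` is required. -/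
def jetMul {n : ℕ} (a b : Sq n × Cube n) : Sq n × Cube n :=
  (fun i j => ∑ l, a.1 i l * b.1 l j,
   fun i j k => ∑ l, a.1 i l * b.2 l j k + ∑ l, ∑ m, a.2 i l m * b.1 l j * b.1 m k)

/-- The group law `(a, ξ)(b, η) = (ab, ξb + η)` of `H ⊆ PGL_{n+1}(ℝ)` in the coordinates
`(a^i_j, a_j)`, in which a point of `H` is the class of the matrix with rows `(a, 0)`, `(ξ, 1)`. -/
def hMul {n : ℕ} (g h : Sq n × (Fin n → ℝ)) : Sq n × (Fin n → ℝ) :=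
  (fun i j => ∑ l, g.1 i l * h.1 l j, fun j => ∑ l, g.2 l * h.1 l j + h.2 j)

/-- The representative `((a, 0), (ξ, 1))` in `GL_{n+1}(ℝ)` of the element `(a, ξ)` of `H`. -/
def hMat {n : ℕ} (h : Sq n × (Fin n → ℝ)) : Matrix (Fin n ⊕ Unit) (Fin n ⊕ Unit) ℝ :=
  Matrix.fromBlocks (Matrix.of h.1) 0 (Matrix.of fun _ j => h.2 j) 1

/-- The element `(a^i_j, -(a^i_j a_k + a_j a^i_k))` of `H² ⊆ G̃²` with coordinates
`(a^i_j, a_j)`. -/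
def hJet {n : ℕ} (h : Sq n × (Fin n → ℝ)) : Sq n × Cube n :=
  (h.1, fun i j k => -(h.1 i j * h.2 k + h.2 j * h.1 i k))

/-- The law `hMul` is matrix multiplication. -/
theorem hMat_hMul {n : ℕ} (g h : Sq n × (Fin n → ℝ)) : hMat (hMul g h) = hMat g * hMat h := by
  ext i j
  rcases i with i | i <;> rcases j with j | j <;>
    simp [hMat, hMul, Matrix.mul_apply]

/-- The bijection `H → H²` is a homomorphism. -/
theorem hJet_hMul {n : ℕ} (g h : Sq n × (Fin n → ℝ)) :
    hJet (hMul g h) = jetMul (hJet g) (hJet h) := by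
  refine Prod.ext rfl ?_
  funext i j k
  simp only [hJet, hMul, jetMul, mul_add, add_mul, neg_mul, mul_neg, Finset.sum_neg_distrib,
    Finset.sum_add_distrib, Finset.mul_sum, Finset.sum_mul]
  have h1 : ∀ x y : Fin n, g.1 i y * h.1 y j * (g.2 x * h.1 x k)
      = g.1 i y * g.2 x * h.1 y j * h.1 x k := fun x y => by ring
  have h2 : ∀ x y : Fin n, g.2 x * h.1 x j * (g.1 i y * h.1 y k)
      = g.2 x * g.1 i y * h.1 x j * h.1 y k := fun x y => by ring
  simp only [h1, h2]
  rw [Finset.sum_comm]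
  have h4 : ∀ x, g.1 i x * h.1 x j * h.2 k = g.1 i x * (h.1 x j * h.2 k) := fun x => by ring
  have h5 : ∀ x, h.2 j * (g.1 i x * h.1 x k) = g.1 i x * (h.2 j * h.1 x k) := fun x => by ring
  simp only [h4, h5]
  have h6 : ∑ x, ∑ y, g.2 y * g.1 i x * h.1 y j * h.1 x k
      = ∑ y, ∑ x, g.2 y * g.1 i x * h.1 y j * h.1 x k := Finset.sum_comm
  have h7 : ∑ y, ∑ x, g.1 i y * g.2 x * h.1 y j * h.1 x k
      = ∑ x, ∑ y, g.1 i y * g.2 x * h.1 y j * h.1 x k := Finset.sum_comm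
  linarith [h6, h7]

/-! ## The Lie algebra -/

/-- `𝔤 = 𝔭𝔤𝔩_{n+1}(ℝ) = 𝔪 ⊕ 𝔤𝔩_n ⊕ 𝔪*`, with elements `(v, U, ζ)`; its subalgebra `𝔥` is
`v = 0`. -/
abbrev LieG (n : ℕ) := (Fin n → ℝ) × Sq n × (Fin n → ℝ)

/-- The representative `((U, v), (ζ, 0))` in `𝔤𝔩_{n+1}(ℝ)` of `(v, U, ζ)`. -/
def toMat {n : ℕ} (X : LieG n) : Matrix (Fin n ⊕ Unit) (Fin n ⊕ Unit) ℝ :=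
  Matrix.fromBlocks (Matrix.of X.2.1) (Matrix.of fun i _ => X.1 i)
    (Matrix.of fun _ j => X.2.2 j) 0

/-- The class modulo scalars of the matrix `((A, v), (ζ, a))`, namely `(v, A - a I, ζ)`. -/
def ofMat {n : ℕ} (Y : Matrix (Fin n ⊕ Unit) (Fin n ⊕ Unit) ℝ) : LieG n :=
  (fun i => Y (.inl i) (.inr ()),
   fun i j => Y (.inl i) (.inl j) - delta i j * Y (.inr ()) (.inr ()),
   fun j => Y (.inr ()) (.inl j))

/-- `Ad_{h⁻¹}` on `𝔤`, for `h ∈ H`. -/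
def adInv {n : ℕ} (h : Sq n × (Fin n → ℝ)) (X : LieG n) : LieG n :=
  ofMat ((hMat h)⁻¹ * toMat X * hMat h)

/-- The coordinate `(v, U, ζ) ↦ v^i`. -/
def c0 {n : ℕ} (i : Fin n) : LieG n →L[ℝ] ℝ :=
  (ContinuousLinearMap.proj i).comp (ContinuousLinearMap.fst ℝ _ _)

/-- The coordinate `(v, U, ζ) ↦ U^i_j`. -/
def c1 {n : ℕ} (i j : Fin n) : LieG n →L[ℝ] ℝ :=
  ((ContinuousLinearMap.proj j).comp (ContinuousLinearMap.proj (φ := fun _ => Fin n → ℝ) i)).comp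
    ((ContinuousLinearMap.fst ℝ _ _).comp (ContinuousLinearMap.snd ℝ _ _))

/-- The coordinate `(v, U, ζ) ↦ ζ_j`. -/
def c2 {n : ℕ} (j : Fin n) : LieG n →L[ℝ] ℝ :=
  (ContinuousLinearMap.proj j).comp
    ((ContinuousLinearMap.snd ℝ _ _).comp (ContinuousLinearMap.snd ℝ _ _))

/-! ## Formal 2-frames in natural coordinates -/

/-- Natural coordinates `(u^i, u^i_j, u^i_{jk})` of formal 2-frames over a chart domain: the part of
`P̃²(M)` over the domain of a chart `e` is the set of these triples with `(u^i)` in the target of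
`e` and `(u^i_j)` invertible. -/
abbrev Frame (n : ℕ) := Vec n × Sq n × Cube n

/-- The right action of `G̃²` on formal 2-frames. -/
def frameMul {n : ℕ} (u : Frame n) (g : Sq n × Cube n) : Frame n := (u.1, jetMul u.2 g)

/-- The partial derivative `∂f/∂x^k`. -/
def pd {n : ℕ} (k : Fin n) (f : Vec n → ℝ) (x : Vec n) : ℝ :=
  fderiv ℝ f x (EuclideanSpace.single k 1)

/-- The 2-jet `(∂ψ^i/∂x^j, ∂²ψ^i/∂x^j∂x^k)` of a map `ψ` at `x`. -/
def jet {n : ℕ} (ψ : Vec n → Vec n) (x : Vec n) : Sq n × Cube n :=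
  (fun i j => pd j (fun y => ψ y i) x, fun i j k => pd k (pd j (fun y => ψ y i)) x)

/-- The component `θ⁰` of the canonical form of `P̃²(M)`: `θ^i = v^i_α du^α`. -/
def theta0 {n : ℕ} (u X : Frame n) (i : Fin n) : ℝ := ∑ α, inv u.2.1 i α * X.1 α

/-- The component `θ¹` of the canonical form of `P̃²(M)`:
`θ^i_j = v^i_α du^α_j - v^i_α u^α_{jβ} v^β_γ du^γ`. -/
def theta1 {n : ℕ} (u X : Frame n) (i j : Fin n) : ℝ :=
  ∑ α, inv u.2.1 i α * X.2.1 α j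
    - ∑ α, ∑ β, ∑ γ, inv u.2.1 i α * u.2.2 α j β * inv u.2.1 β γ * X.1 γ

/-! ## Affine connections in charts -/

section Manifold

variable {n : ℕ} {M : Type*} [TopologicalSpace M] [ChartedSpace (Vec n) M]

/-- The type of affine connections, that is, covariant derivatives on `TM`. -/
abbrev AffConn (n : ℕ) (M : Type*) [TopologicalSpace M] [ChartedSpace (Vec n) M]
    [IsManifold (𝓡 n) ∞ M] :=
  CovariantDerivative (𝓡 n) (Vec n) (TangentSpace (𝓡 n) : M → Type)

/-- The coordinate change from the chart `e` to the chart `e'`. -/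
def transition (e e' : OpenPartialHomeomorph M (Vec n)) : Vec n → Vec n := fun x => e' (e.symm x)

/-- The change of natural coordinates of formal 2-frames from `e` to `e'`. -/
def frameTransition (e e' : OpenPartialHomeomorph M (Vec n)) (u : Frame n) : Frame n :=
  (transition e e' u.1, jetMul (jet (transition e e') u.1) u.2)

/-- The coordinate vector field `∂/∂x^j` of the chart `e`. -/
def coordField (e : OpenPartialHomeomorph M (Vec n)) (j : Fin n) (p : M) :
    TangentSpace (𝓡 n) p :=
  (mfderiv (𝓡 n) (𝓡 n) e p).inverse (EuclideanSpace.single j 1 : Vec n)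

/-- Product coordinates `(x^i, a^i_j, a_j)` on the part over a chart domain
of a projective structure `P ⊆ P̃²(M)`, with respect to a section of `P` over that domain. -/
abbrev PCoord (n : ℕ) := Vec n × Sq n × (Fin n → ℝ)

/-- The range of the product coordinates over the domain of `e`; an open set. -/
def pDomain (e : OpenPartialHomeomorph M (Vec n)) : Set (PCoord n) :=
  {w | w.1 ∈ e.target ∧ Inv w.2.1}

variable [IsManifold (𝓡 n) ∞ M]

/-- The Christoffel symbols `Γ^i_{jk} = dx^i(∇_{∂/∂x^k} ∂/∂x^j)` in the chart `e`, as functions of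
the coordinates; note the order of `j` and `k`. -/
def christoffel (nabla : AffConn n M) (e : OpenPartialHomeomorph M (Vec n)) (i j k : Fin n)
    (x : Vec n) : ℝ :=
  (EuclideanSpace.proj i : Vec n →L[ℝ] ℝ) (mfderiv (𝓡 n) (𝓡 n) e (e.symm x)
    (nabla (coordField e j) (e.symm x) (coordField e k (e.symm x))))

/-- The reduced torsion `μ_j = ½(Γ^α_{αj} - Γ^α_{jα})`. -/
def mu (nabla : AffConn n M) (e : OpenPartialHomeomorph M (Vec n)) (j : Fin n) (x : Vec n) : ℝ :=
  (1 / 2) * (∑ α, christoffel nabla e α α j x - ∑ α, christoffel nabla e α j α x)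

/-- `ν_j = -(Γ^α_{αj} + Γ^α_{jα}) / (2(n+1))`. -/
def nu (nabla : AffConn n M) (e : OpenPartialHomeomorph M (Vec n)) (j : Fin n) (x : Vec n) : ℝ :=
  -(1 / (2 * ((n : ℝ) + 1))) *
    (∑ α, christoffel nabla e α α j x + ∑ α, christoffel nabla e α j α x)

/-! ## The projective structure determined by an affine connection -/

/-- The formal 2-frame `(x, δ^i_j, -Γ^i_{jk})`, which represents the section of `P̃²(M)/G̃¹` given by
the connection. -/
def connFrame (nabla : AffConn n M) (e : OpenPartialHomeomorph M (Vec n)) (x : Vec n) : Frame n :=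
  (x, delta, fun i j k => -christoffel nabla e i j k x)

/-- The part over the domain of `e` of the projective structure `P ⊆ P̃²(M)` determined by the
connection: the `H²`-orbits of the frames `(x, δ^i_j, -Γ^i_{jk})`. -/
def projStructure (nabla : AffConn n M) (e : OpenPartialHomeomorph M (Vec n)) : Set (Frame n) :=
  {u | ∃ x ∈ e.target, ∃ h : Sq n × (Fin n → ℝ), Inv h.1 ∧
    u = frameMul (connFrame nabla e x) (hJet h)}

/-- The formal 2-frame with product coordinates `w`. -/
def pFrame (nabla : AffConn n M) (e : OpenPartialHomeomorph M (Vec n)) (w : PCoord n) : Frame n :=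
  frameMul (connFrame nabla e w.1) (hJet w.2)

/-- The product coordinates are a bijection onto the part of `P` over the domain of `e`. -/
theorem bijOn_pFrame (nabla : AffConn n M) (e : OpenPartialHomeomorph M (Vec n)) :
    Set.BijOn (pFrame nabla e) (pDomain e) (projStructure nabla e) := by
  refine ⟨fun w hw => ⟨w.1, hw.1, w.2, hw.2, rfl⟩, ?_, ?_⟩
  · rintro ⟨x, a, ξ⟩ hw ⟨x', a', ξ'⟩ hw' h
    have hx : x = x' := congrArg Prod.fst h
    have ha : a = a' := by
      have := congrArg (fun u : Frame n => u.2.1) h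
      simpa [pFrame, frameMul, connFrame, jetMul, hJet, delta] using this
    subst hx ha
    have h2 : ∀ i j k, a i j * ξ k + ξ j * a i k = a i j * ξ' k + ξ' j * a i k := by
      intro i j k
      have := congrFun (congrFun (congrFun (congrArg (fun u : Frame n => u.2.2) h) i) j) k
      simp [pFrame, frameMul, connFrame, jetMul, hJet, delta] at this
      linarith
    have h3 : ξ = ξ' := by
      funext j
      by_contra hne
      refine hw.2 (Matrix.det_eq_zero_of_column_eq_zero j fun i => ?_)
      have h4 : a i j * (ξ j - ξ' j) = 0 := by linarith [h2 i j j]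
      exact (mul_eq_zero.mp h4).resolve_right (sub_ne_zero.mpr hne)
    rw [h3]
  · rintro u ⟨x, hx, h, hh, rfl⟩
    exact ⟨(x, h), ⟨hx, hh⟩, rfl⟩

/-- The right action of `H` in product coordinates. -/
def pMul (w : PCoord n) (h : Sq n × (Fin n → ℝ)) : PCoord n := (w.1, hMul w.2 h)

/-- In product coordinates, the restriction to `P` of the component `θ⁰` of the canonical form. -/
def pTheta0 (nabla : AffConn n M) (e : OpenPartialHomeomorph M (Vec n)) (w X : PCoord n)
    (i : Fin n) : ℝ :=
  theta0 (pFrame nabla e w) (fderiv ℝ (pFrame nabla e) w X) i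

/-- In product coordinates, the restriction to `P` of the component `θ¹` of the canonical form. -/
def pTheta1 (nabla : AffConn n M) (e : OpenPartialHomeomorph M (Vec n)) (w X : PCoord n)
    (i j : Fin n) : ℝ :=
  theta1 (pFrame nabla e w) (fderiv ℝ (pFrame nabla e) w X) i j

/-! ## Normal projective connections -/

/-- A 1-form on `PCoord n` with values in `𝔤`. -/
abbrev GForm (n : ℕ) := PCoord n → PCoord n →L[ℝ] LieG n

/-- The wedge product `α ∧ β` of two scalar 1-forms at a point, evaluated at `(X, Y)`. -/
def wedge (α β : PCoord n →L[ℝ] ℝ) (X Y : PCoord n) : ℝ := α X * β Y - α Y * β X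

/-- The exterior derivative of a scalar 1-form `α` at `w`, evaluated at `(X, Y)`. -/
def dForm (α : PCoord n → PCoord n →L[ℝ] ℝ) (w X Y : PCoord n) : ℝ :=
  extDeriv (fun w' => ContinuousAlternatingMap.ofSubsingleton ℝ (PCoord n) ℝ (0 : Fin 1) (α w')) w
    ![X, Y]

/-- The curvature matrix
`Ω^i_j = d(om^i_j) + om^i_k ∧ om^k_j + om^i ∧ om_j - δ^i_j om_k ∧ om^k` at `w`, evaluated at `(X, Y)`. -/
def curvature (om : GForm n) (i j : Fin n) (w X Y : PCoord n) : ℝ :=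
  dForm (fun w' => (c1 i j).comp (om w')) w X Y
    + ∑ k, wedge ((c1 i k).comp (om w)) ((c1 k j).comp (om w)) X Y
    + wedge ((c0 i).comp (om w)) ((c2 j).comp (om w)) X Y
    - delta i j * ∑ k, wedge ((c2 k).comp (om w)) ((c0 k).comp (om w)) X Y

/-- `om` is Ricci-flat at `w`: `Ω^i_j = ½ K^i_{jkl} om^k ∧ om^l` with `K^i_{jlk} = -K^i_{jkl}` and
`K^i_{jil} = 0` at `w`. -/
def RicciFlatAt (om : GForm n) (w : PCoord n) : Prop :=
  ∃ K : Fin n → Fin n → Fin n → Fin n → ℝ,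
    (∀ i j k l, K i j l k = -K i j k l) ∧
    (∀ i j X Y, curvature om i j w X Y =
      (1 / 2) * ∑ k, ∑ l, K i j k l * wedge ((c0 k).comp (om w)) ((c0 l).comp (om w)) X Y) ∧
    ∀ j l, ∑ i, K i j i l = 0

/-- `om` is a normal projective connection for the projective structure `P` determined by `nabla`.
A 1-form on `P` is given by its expressions `om e` in the product coordinates over the domains of all
smooth charts `e`; only their values on `pDomain e` matter, and they have to agree on overlaps.

Equivariance `R_h^* om = Ad_{h⁻¹} om` is required for all `h ∈ H²` for the components `om^i` and
`om^i_j`, and for all `h ∈ G̃¹ = GL_n(ℝ)` for `om_j`. It is not required for `om_j` under all of `H²`: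
this is the only respect in which `om` may fail to be a Cartan connection, and unless `nabla` is
torsion-free no Cartan connection has the other properties, because `K^i_{jil}` is not constant
along the fibres then. A Cartan connection that has them is a normal projective connection in the
present sense. -/
structure IsNormalProjectiveConnection (nabla : AffConn n M)
    (om : OpenPartialHomeomorph M (Vec n) → GForm n) : Prop where
  /-- `om` is smooth. -/
  smooth : ∀ e ∈ IsManifold.maximalAtlas (𝓡 n) ∞ M, ContDiffOn ℝ ∞ (om e) (pDomain e)
  /-- The local expressions agree on overlaps: `τ` is the change of product coordinates of `P`. -/
  compat : ∀ e ∈ IsManifold.maximalAtlas (𝓡 n) ∞ M, ∀ e' ∈ IsManifold.maximalAtlas (𝓡 n) ∞ M,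
    ∀ τ : PCoord n → PCoord n,
      ContDiffOn ℝ ∞ τ {w ∈ pDomain e | e.symm w.1 ∈ e'.source} →
      (∀ w ∈ pDomain e, e.symm w.1 ∈ e'.source →
        τ w ∈ pDomain e' ∧ pFrame nabla e' (τ w) = frameTransition e e' (pFrame nabla e w)) →
      ∀ w ∈ pDomain e, e.symm w.1 ∈ e'.source → (om e' (τ w)).comp (fderiv ℝ τ w) = om e w
  /-- `om(A*) = A` for `A = (U, ζ) ∈ 𝔥`; the value of `A*` at `w` is the derivative at the identity,
  in direction `A`, of `h ↦ w.h`. -/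
  fundamental : ∀ e ∈ IsManifold.maximalAtlas (𝓡 n) ∞ M, ∀ w ∈ pDomain e,
    ∀ A : Sq n × (Fin n → ℝ), om e w (fderiv ℝ (pMul w) (delta, 0) A) = (0, A.1, A.2)
  /-- Equivariance of `(om^i, om^i_j)` under `H²`. -/
  equivariant : ∀ e ∈ IsManifold.maximalAtlas (𝓡 n) ∞ M, ∀ w ∈ pDomain e,
    ∀ h : Sq n × (Fin n → ℝ), Inv h.1 → ∀ X : PCoord n,
      (om e (pMul w h) (fderiv ℝ (fun w' => pMul w' h) w X)).1 = (adInv h (om e w X)).1 ∧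
      (om e (pMul w h) (fderiv ℝ (fun w' => pMul w' h) w X)).2.1 = (adInv h (om e w X)).2.1
  /-- Equivariance of `om` under `G̃¹ = GL_n(ℝ)`. -/
  equivariant_linear : ∀ e ∈ IsManifold.maximalAtlas (𝓡 n) ∞ M, ∀ w ∈ pDomain e,
    ∀ a : Sq n, Inv a → ∀ X : PCoord n,
      om e (pMul w (a, 0)) (fderiv ℝ (fun w' => pMul w' (a, 0)) w X) = adInv (a, 0) (om e w X)
  /-- `om(X) ≠ 0` for non-zero `X`. -/
  ne_zero : ∀ e ∈ IsManifold.maximalAtlas (𝓡 n) ∞ M, ∀ w ∈ pDomain e,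
    ∀ X : PCoord n, X ≠ 0 → om e w X ≠ 0
  /-- `(om^i, om^i_j)` is the restriction of the canonical form of `P̃²(M)` to `P`. -/
  canonical0 : ∀ e ∈ IsManifold.maximalAtlas (𝓡 n) ∞ M, ∀ w ∈ pDomain e,
    ∀ X i, (om e w X).1 i = pTheta0 nabla e w X i
  canonical1 : ∀ e ∈ IsManifold.maximalAtlas (𝓡 n) ∞ M, ∀ w ∈ pDomain e,
    ∀ X i j, (om e w X).2.1 i j = pTheta1 nabla e w X i j
  /-- `om` is Ricci-flat: `K^i_{jil} = 0`. -/
  ricciFlat : ∀ e ∈ IsManifold.maximalAtlas (𝓡 n) ∞ M, ∀ w ∈ pDomain e, RicciFlatAt (om e) w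

/-! ## Sections of `P` over a chart domain -/

/-- `σ` is, in product coordinates, a smooth section of `P` over the domain of the chart `e`. -/
structure IsLocalSection (e : OpenPartialHomeomorph M (Vec n)) (σ : Vec n → PCoord n) : Prop where
  smooth : ContDiffOn ℝ ∞ σ e.target
  mem : ∀ x ∈ e.target, σ x ∈ pDomain e
  base : ∀ x ∈ e.target, (σ x).1 = x

/-- The pull-back `σ^*om` at `x`, evaluated at `v`. -/
def pullback (om : GForm n) (σ : Vec n → PCoord n) (x v : Vec n) : LieG n :=
  om (σ x) (fderiv ℝ σ x v)

/-- `Π^i_{jk}`, defined by `σ^*om^i_j = Π^i_{jk} dx^k`. -/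
def coeffPi (om : GForm n) (σ : Vec n → PCoord n) (i j k : Fin n) (x : Vec n) : ℝ :=
  (pullback om σ x (EuclideanSpace.single k 1)).2.1 i j

/-- `Π_{jk}`, defined by `σ^*om_j = Π_{jk} dx^k`. -/
def coeffP (om : GForm n) (σ : Vec n → PCoord n) (j k : Fin n) (x : Vec n) : ℝ :=
  (pullback om σ x (EuclideanSpace.single k 1)).2.2 j

/-- Condition 1): `σ^*om^i = dx^i` on the domain of `e`. -/
def Cond1 (om : GForm n) (e : OpenPartialHomeomorph M (Vec n)) (σ : Vec n → PCoord n) : Prop :=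
  ∀ x ∈ e.target, ∀ v i, (pullback om σ x v).1 i = v i

/-- Condition 2): `Π^i_{ik} = μ_k` on the domain of `e`. -/
def Cond2 (nabla : AffConn n M) (om : GForm n) (e : OpenPartialHomeomorph M (Vec n))
    (σ : Vec n → PCoord n) : Prop :=
  ∀ x ∈ e.target, ∀ k, ∑ i, coeffPi om σ i i k x = mu nabla e k x

/-- Condition 2'): `Π^i_{ji} = -μ_j` on the domain of `e`. -/
def Cond2' (nabla : AffConn n M) (om : GForm n) (e : OpenPartialHomeomorph M (Vec n))
    (σ : Vec n → PCoord n) : Prop :=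
  ∀ x ∈ e.target, ∀ j, ∑ i, coeffPi om σ i j i x = -mu nabla e j x

/-- The expression `∂Π^i_{jk}/∂x^i + ∂μ_j/∂x^k - μ_α Π^α_{jk} - Π^α_{jβ} Π^β_{αk}`. -/
def ricciTerm (nabla : AffConn n M) (om : GForm n) (e : OpenPartialHomeomorph M (Vec n))
    (σ : Vec n → PCoord n) (j k : Fin n) (x : Vec n) : ℝ :=
  ∑ i, pd i (coeffPi om σ i j k) x + pd k (mu nabla e j) x
    - ∑ α, mu nabla e α x * coeffPi om σ α j k x
    - ∑ α, ∑ β, coeffPi om σ α j β x * coeffPi om σ β α k x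

end Manifold

end ProjConn

end

namespace ProjConn

/-! ### Linear algebra in index notation. -/

section Algebra

variable {n : ℕ}

/-! In product coordinates `(x, a, ξ)` on `P` the canonical form has `ω^i = (a⁻¹)^i_α dx^α`, so
condition 1 forces `a = δ` (`cond1_iff`). Along the slice `a = δ` one has `ω^i_j = da^i_j +
(Γ^i_{jk} + δ^i_j ξ_k + δ^i_k ξ_j) dx^k` (`apply_snd_fst`), so a section `(x, δ, ξ)` has `Π^i_{jk}`
equal to the bracket. Its two traces are `μ_k + (n+1)(ξ_k - ν_k)` and `-μ_j + (n+1)(ξ_j - ν_j)`;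
hence 2 and 2' both mean `ξ = ν` (`cond2_iff`, `cond2'_iff`). This gives existence, uniqueness and
the formula for `Π^i_{jk}`.

For `Π_{jk}`, pull the structure equation back by `σ` (`curvature_pullback`). As `σ^*ω^i = dx^i`,
the `K^i_{jkl}` are the coordinate components of `σ^*Ω^i_j`, and `K^i_{jil} = 0` becomes `n Π_{jl} -
Π_{lj} = -R_{jl}` (`trace_system`). Together with its transpose this determines `Π`, because `n² ≠
1`. -/

theorem of_delta : Matrix.of (delta : Sq n) = 1 := by
  ext i j
  simp [delta, Matrix.one_apply]

theorem inv_delta : inv (delta : Sq n) = delta := by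
  funext i j
  simp [inv, of_delta, delta, Matrix.one_apply]

theorem Inv_delta : Inv (delta : Sq n) := by
  simp [Inv, of_delta]

/-- Invertibility of `a` comes for free: a singular matrix has inverse `0` by convention, and `0 ≠
1` unless `n = 0`, where the empty determinant is a unit. -/
theorem eq_delta_of_inv_eq_delta {a : Sq n} (h : inv a = delta) : a = delta := by
  have h1 : (Matrix.of a)⁻¹ = 1 := by
    rw [← of_delta, ← h]
    rfl
  have h2 : IsUnit (Matrix.of a).det := by
    by_contra h2
    rw [Matrix.nonsing_inv_apply_not_isUnit _ h2] at h1
    rcases isEmpty_or_nonempty (Fin n) with _ | _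
    · exact h2 (by simp)
    · exact zero_ne_one h1
  have h3 : Matrix.of a = 1 := by
    rw [← Matrix.nonsing_inv_nonsing_inv _ h2, h1, inv_one]
  rw [← of_delta] at h3
  exact Matrix.of.injective h3

/-- The linear system `n P_{jk} - P_{kj} = -R_{jk}` determines `P` for `n ≥ 2`. -/
theorem eq_of_trace_system (hn : 2 ≤ n) {P R : Fin n → Fin n → ℝ}
    (h : ∀ j k, (n : ℝ) * P j k - P k j = -R j k) (j k : Fin n) :
    P j k = -1 / ((n : ℝ) ^ 2 - 1) * ((n : ℝ) * R j k + R k j) := by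
  have hn' : (2 : ℝ) ≤ n := by exact_mod_cast hn
  have hne : (n : ℝ) ^ 2 - 1 ≠ 0 := by nlinarith
  field_simp
  -- Adding the transposed equation to `n` times the equation cancels `P k j` and leaves `(n² - 1) P
  -- j k`.
  linear_combination (n : ℝ) * h j k + h k j

/-- The Ricci contraction of a form `½ K_{kl} dx^k ∧ dx^l` with `K` antisymmetric. -/
theorem half_sum_delta_wedge {K : Fin n → Fin n → ℝ} (hK : ∀ k l, K l k = -K k l) (p q : Fin n) :
    (1 / 2) * ∑ k, ∑ l, K k l * (delta k p * delta l q - delta k q * delta l p) = K p q := by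
  simp only [mul_sub, Finset.sum_sub_distrib, delta, mul_ite, mul_one, mul_zero,
    Finset.sum_ite_eq', Finset.mem_univ, if_true]
  rw [hK p q]
  ring

end Algebra

/-! ### Exterior derivatives under pull-back. -/

section Form

variable {n : ℕ}

/-- The exterior derivative of a scalar 1-form commutes with pull-back. -/
theorem dForm_pullback {α : PCoord n → PCoord n →L[ℝ] ℝ} {σ : Vec n → PCoord n} {x : Vec n}
    (hα : DifferentiableAt ℝ α (σ x)) (hσ : ContDiffAt ℝ ∞ σ x) (v w : Vec n) :
    dForm α (σ x) (fderiv ℝ σ x v) (fderiv ℝ σ x w) =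
      fderiv ℝ (fun y => α (σ y) (fderiv ℝ σ y w)) x v
        - fderiv ℝ (fun y => α (σ y) (fderiv ℝ σ y v)) x w := by
  -- Seen as a linear isometry, the passage from 1-forms to alternating maps preserves
  -- differentiability.
  have hsub : ∀ β : PCoord n →L[ℝ] ℝ,
      ContinuousAlternatingMap.ofSubsingleton ℝ (PCoord n) ℝ (0 : Fin 1) β =
        ContinuousAlternatingMap.ofSubsingletonLIE (𝕜 := ℝ) (0 : Fin 1) β := fun _ => rfl
  have hω : DifferentiableAt ℝ (fun u =>
      ContinuousAlternatingMap.ofSubsingleton ℝ (PCoord n) ℝ (0 : Fin 1) (α u)) (σ x) := by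
    simp only [hsub]
    exact (LinearIsometryEquiv.differentiable _).differentiableAt.comp _ hα
  have h1 := extDeriv_pullback (r := ∞) hω hσ
    (by rw [minSmoothness_of_isRCLikeNormedField]; exact ENat.LEInfty.out)
  have h2 := congrArg (fun φ => φ ![v, w]) h1
  have hdσ : DifferentiableAt ℝ (fderiv ℝ σ) x :=
    (hσ.fderiv_right (m := ∞) le_rfl).differentiableAt (by simp)
  have hpb : DifferentiableAt ℝ (fun y => (ContinuousAlternatingMap.ofSubsingleton ℝ (PCoord n) ℝ
      (0 : Fin 1) (α (σ y))).compContinuousLinearMap (fderiv ℝ σ y)) x := by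
    have : (fun y => (ContinuousAlternatingMap.ofSubsingleton ℝ (PCoord n) ℝ
        (0 : Fin 1) (α (σ y))).compContinuousLinearMap (fderiv ℝ σ y)) =
        fun y => ContinuousAlternatingMap.ofSubsingletonLIE (𝕜 := ℝ) (0 : Fin 1)
          ((α (σ y)).comp (fderiv ℝ σ y)) := by
      funext y
      ext u
      simp
    rw [this]
    exact (LinearIsometryEquiv.differentiable _).differentiableAt.comp _
      ((hα.comp x (hσ.differentiableAt (by simp))).clm_comp hdσ)
  -- `v` and `w` are constant fields on `ℝⁿ`, so no bracket term appears.
  rw [extDeriv_apply hpb] at h2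
  have h3 : ![fderiv ℝ σ x v, fderiv ℝ σ x w] = fderiv ℝ σ x ∘ ![v, w] := by
    ext1 i
    fin_cases i <;> rfl
  rw [dForm, h3, sub_eq_add_neg]
  simpa [Fin.sum_univ_two, Fin.removeNth] using h2.symm

theorem isOpen_pDomain {M : Type*} [TopologicalSpace M] [ChartedSpace (Vec n) M]
    (e : OpenPartialHomeomorph M (Vec n)) : IsOpen (pDomain e) := by
  refine (e.open_target.preimage continuous_fst).inter (isOpen_ne_fun ?_ continuous_const)
  exact Continuous.matrix_det (continuous_fst.comp continuous_snd)

end Form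

/-! ### Differentials of sections in product coordinates. -/

section LocalSection

variable {n : ℕ} {M : Type*} [TopologicalSpace M] {e : OpenPartialHomeomorph M (Vec n)}

theorem IsLocalSection.contDiffAt {σ : Vec n → PCoord n} (hσ : IsLocalSection e σ) {x : Vec n}
    (hx : x ∈ e.target) : ContDiffAt ℝ ∞ σ x :=
  hσ.smooth.contDiffAt (e.open_target.mem_nhds hx)

theorem IsLocalSection.fderiv_fst {σ : Vec n → PCoord n} (hσ : IsLocalSection e σ) {x : Vec n}
    (hx : x ∈ e.target) (v : Vec n) : (fderiv ℝ σ x v).1 = v := by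
  have h1 : HasFDerivAt (fun y => (σ y).1) _ x :=
    ((hσ.contDiffAt hx).differentiableAt (by simp)).hasFDerivAt.fst
  have h2 : HasFDerivAt (fun y => (σ y).1) (ContinuousLinearMap.id ℝ (Vec n)) x :=
    (hasFDerivAt_id x).congr_of_eventuallyEq
      (Filter.eventually_of_mem (e.open_target.mem_nhds hx) hσ.base)
  exact congrArg (fun L => L v) (h1.unique h2)

theorem IsLocalSection.fderiv_snd_fst {σ : Vec n → PCoord n} (hσ : IsLocalSection e σ)
    (ha : ∀ x ∈ e.target, (σ x).2.1 = delta) {x : Vec n}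
    (hx : x ∈ e.target) (v : Vec n) : (fderiv ℝ σ x v).2.1 = 0 := by
  have h1 : HasFDerivAt (fun y => (σ y).2.1) _ x :=
    ((hσ.contDiffAt hx).differentiableAt (by simp)).hasFDerivAt.snd.fst
  have h2 : HasFDerivAt (fun y => (σ y).2.1) (0 : Vec n →L[ℝ] Sq n) x :=
    (hasFDerivAt_const delta x).congr_of_eventuallyEq
      (Filter.eventually_of_mem (e.open_target.mem_nhds hx) ha)
  exact congrArg (fun L => L v) (h1.unique h2)

end LocalSection

/-! ### The canonical form on `P` in product coordinates. -/

section Connection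

variable {n : ℕ} {M : Type*} [TopologicalSpace M] [ChartedSpace (Vec n) M] [IsManifold (𝓡 n) ∞ M]
  {nabla : AffConn n M} {om : OpenPartialHomeomorph M (Vec n) → GForm n}
  {e : OpenPartialHomeomorph M (Vec n)}

theorem pFrame_snd_fst (nabla : AffConn n M) (e : OpenPartialHomeomorph M (Vec n)) (w : PCoord n) :
    (pFrame nabla e w).2.1 = w.2.1 := by
  funext i j
  simp [pFrame, frameMul, connFrame, jetMul, hJet, delta]

theorem theta1_zero (u : Frame n) (i j : Fin n) : theta1 u 0 i j = 0 := by
  simp [theta1]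

/-- The restriction of the canonical form to `P` is only meaningful where the Christoffel symbols
are differentiable; that they are is forced by `om(A*) = A`. -/
theorem IsNormalProjectiveConnection.differentiableAt_pFrame (hn : 0 < n)
    (hom : IsNormalProjectiveConnection nabla om) (he : e ∈ IsManifold.maximalAtlas (𝓡 n) ∞ M)
    {w : PCoord n} (hw : w ∈ pDomain e) : DifferentiableAt ℝ (pFrame nabla e) w := by
  by_contra h
  have h1 := hom.fundamental e he w hw (delta, 0)
  have h2 := hom.canonical1 e he w hw (fderiv ℝ (pMul w) (delta, 0) (delta, 0)) ⟨0, hn⟩ ⟨0, hn⟩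
  -- Without differentiability `fderiv` takes its default value `0`, so `θ¹` would vanish, whereas
  -- `A = (δ, 0)` has diagonal entries `1`.
  rw [h1, pTheta1, fderiv_zero_of_not_differentiableAt h] at h2
  simp [theta1_zero, delta] at h2

/-- `θ⁰` and `θ¹` involve only the first two components of a velocity, so the component carrying
derivatives of `Γ` never has to be computed. -/
theorem fderiv_pFrame_fst {w : PCoord n} (h : DifferentiableAt ℝ (pFrame nabla e) w)
    (X : PCoord n) : (fderiv ℝ (pFrame nabla e) w X).1 = X.1 := by
  have h1 : HasFDerivAt (fun w => (pFrame nabla e w).1) _ w := h.hasFDerivAt.fst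
  have h2 : HasFDerivAt (fun w : PCoord n => (pFrame nabla e w).1)
    (ContinuousLinearMap.fst ℝ _ _) w := hasFDerivAt_fst
  exact congrArg (fun L => L X) (h1.unique h2)

theorem fderiv_pFrame_snd_fst {w : PCoord n} (h : DifferentiableAt ℝ (pFrame nabla e) w)
    (X : PCoord n) : (fderiv ℝ (pFrame nabla e) w X).2.1 = X.2.1 := by
  have h1 : HasFDerivAt (fun w => (pFrame nabla e w).2.1) _ w := h.hasFDerivAt.snd.fst
  have h2 : HasFDerivAt (fun w : PCoord n => w.2.1) _ w := (hasFDerivAt_snd (𝕜 := ℝ) (p := w)).fst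
  simp only [pFrame_snd_fst] at h1
  exact congrArg (fun L => L X) (h1.unique h2)

theorem IsNormalProjectiveConnection.apply_fst (hn : 0 < n)
    (hom : IsNormalProjectiveConnection nabla om) (he : e ∈ IsManifold.maximalAtlas (𝓡 n) ∞ M)
    {w : PCoord n} (hw : w ∈ pDomain e) (X : PCoord n) (i : Fin n) :
    (om e w X).1 i = ∑ α, inv w.2.1 i α * X.1 α := by
  rw [hom.canonical0 e he w hw, pTheta0, theta0, pFrame_snd_fst,
    fderiv_pFrame_fst (hom.differentiableAt_pFrame hn he hw)]

/-- The components `om^i_j` along the part `a^i_j = δ^i_j` of `P`. -/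
theorem IsNormalProjectiveConnection.apply_snd_fst (hn : 0 < n)
    (hom : IsNormalProjectiveConnection nabla om) (he : e ∈ IsManifold.maximalAtlas (𝓡 n) ∞ M)
    {x : Vec n} (hx : x ∈ e.target) (ξ : Fin n → ℝ) (X : PCoord n) (i j : Fin n) :
    (om e (x, delta, ξ) X).2.1 i j =
      X.2.1 i j + ∑ γ, (christoffel nabla e i j γ x + delta i j * ξ γ + delta i γ * ξ j) * X.1 γ := by
  have hw : ((x, delta, ξ) : PCoord n) ∈ pDomain e := ⟨hx, Inv_delta⟩
  have hd := hom.differentiableAt_pFrame hn he hw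
  rw [hom.canonical1 e he _ hw, pTheta1, theta1, pFrame_snd_fst, fderiv_pFrame_fst hd,
    fderiv_pFrame_snd_fst hd, inv_delta]
  -- The signs in `(x, δ, -Γ)` and in `hJet` combine into one minus sign, which cancels the one in
  -- `θ¹`.
  have h2 : ∀ i j k, (pFrame nabla e (x, delta, ξ)).2.2 i j k =
      -(christoffel nabla e i j k x + delta i j * ξ k + delta i k * ξ j) := by
    intro i j k
    simp [pFrame, frameMul, connFrame, jetMul, hJet, delta]
    ring
  simp only [h2]
  simp only [delta, ite_mul, mul_ite, one_mul, zero_mul, mul_one, mul_zero, Finset.sum_ite_eq,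
    Finset.mem_univ, if_true, Finset.sum_ite_irrel, Finset.sum_const_zero, neg_mul,
    Finset.sum_neg_distrib, sub_neg_eq_add]

/-- `Γ^i_{jk}(x)` is the value of the smooth form `om^i_j` at `(x, δ, 0)` on `∂/∂x^k`. -/
theorem IsNormalProjectiveConnection.contDiffOn_christoffel (hn : 0 < n)
    (hom : IsNormalProjectiveConnection nabla om) (he : e ∈ IsManifold.maximalAtlas (𝓡 n) ∞ M)
    (i j k : Fin n) : ContDiffOn ℝ ∞ (christoffel nabla e i j k) e.target := by
  have h1 : ContDiffOn ℝ ∞ (fun x : Vec n => c1 i j (om e (x, delta, 0)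
      (EuclideanSpace.single k 1, 0, 0))) e.target := by
    refine (c1 i j).contDiff.comp_contDiffOn (ContDiffOn.clm_apply ?_ contDiffOn_const)
    exact (hom.smooth e he).comp (contDiff_id.prodMk contDiff_const).contDiffOn
      fun x hx => ⟨hx, Inv_delta⟩
  refine h1.congr fun x hx => ?_
  have h2 := hom.apply_snd_fst hn he hx 0 (EuclideanSpace.single k 1, 0, 0) i j
  exact Eq.symm (by simpa [Pi.single_apply, c1] using h2)

theorem IsNormalProjectiveConnection.contDiffOn_nu (hn : 0 < n)
    (hom : IsNormalProjectiveConnection nabla om) (he : e ∈ IsManifold.maximalAtlas (𝓡 n) ∞ M)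
    (j : Fin n) : ContDiffOn ℝ ∞ (nu nabla e j) e.target :=
  contDiffOn_const.mul <| (ContDiffOn.sum fun _ _ => hom.contDiffOn_christoffel hn he _ _ _).add
    (ContDiffOn.sum fun _ _ => hom.contDiffOn_christoffel hn he _ _ _)

/-! ### What the normalising conditions say about a section. -/

/-- Condition 1) says that the section lies in the part `a^i_j = δ^i_j` of `P`. -/
theorem cond1_iff (hn : 0 < n) (hom : IsNormalProjectiveConnection nabla om)
    (he : e ∈ IsManifold.maximalAtlas (𝓡 n) ∞ M) {σ : Vec n → PCoord n}
    (hσ : IsLocalSection e σ) : Cond1 (om e) e σ ↔ ∀ x ∈ e.target, (σ x).2.1 = delta := by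
  have h : ∀ x ∈ e.target, ∀ v i,
      (pullback (om e) σ x v).1 i = ∑ α, inv (σ x).2.1 i α * v α := by
    intro x hx v i
    rw [pullback, hom.apply_fst hn he (hσ.mem x hx), hσ.fderiv_fst hx]
  constructor
  · intro h1 x hx
    refine eq_delta_of_inv_eq_delta ?_
    funext i j
    have h2 := (h x hx (EuclideanSpace.single j 1) i).symm.trans (h1 x hx _ i)
    simpa [Pi.single_apply, delta] using h2
  · intro ha x hx v i
    rw [h x hx, ha x hx, inv_delta]
    simp [delta]

/-- The coefficients `Π^i_{jk}` of a section `(δ^i_j, ξ_j)`. -/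
theorem coeffPi_eq (hn : 0 < n) (hom : IsNormalProjectiveConnection nabla om)
    (he : e ∈ IsManifold.maximalAtlas (𝓡 n) ∞ M) {σ : Vec n → PCoord n}
    (hσ : IsLocalSection e σ) (ha : ∀ x ∈ e.target, (σ x).2.1 = delta) {x : Vec n}
    (hx : x ∈ e.target) (i j k : Fin n) :
    coeffPi (om e) σ i j k x =
      christoffel nabla e i j k x + delta i j * (σ x).2.2 k + delta i k * (σ x).2.2 j := by
  have h1 : σ x = (x, delta, (σ x).2.2) :=
    Prod.ext (hσ.base x hx) (Prod.ext (ha x hx) rfl)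
  have h2 := hom.apply_snd_fst hn he hx (σ x).2.2 (fderiv ℝ σ x (EuclideanSpace.single k 1)) i j
  rw [← h1, hσ.fderiv_fst hx, hσ.fderiv_snd_fst ha hx] at h2
  rw [coeffPi, pullback, h2]
  simp

theorem sum_delta_self : ∑ i : Fin n, delta i i = (n : ℝ) := by
  simp [delta]

theorem sum_delta_mul (j : Fin n) (f : Fin n → ℝ) : ∑ i, delta i j * f i = f j := by
  simp [delta]

/-- By the definitions of `μ` and `ν`, `Γ^α_{αk} = μ_k - (n+1) ν_k`; the two Kronecker terms
contribute `n ξ_k` and `ξ_k`. -/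
theorem sum_coeffPi_left (hn : 0 < n) (hom : IsNormalProjectiveConnection nabla om)
    (he : e ∈ IsManifold.maximalAtlas (𝓡 n) ∞ M) {σ : Vec n → PCoord n}
    (hσ : IsLocalSection e σ) (ha : ∀ x ∈ e.target, (σ x).2.1 = delta) {x : Vec n}
    (hx : x ∈ e.target) (k : Fin n) :
    ∑ i, coeffPi (om e) σ i i k x =
      mu nabla e k x + (n + 1) * ((σ x).2.2 k - nu nabla e k x) := by
  have hn1 : (n : ℝ) + 1 ≠ 0 := by positivity
  simp only [coeffPi_eq hn hom he hσ ha hx, Finset.sum_add_distrib, ← Finset.sum_mul,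
    sum_delta_self, sum_delta_mul, mu, nu]
  field_simp
  ring

/-- Here `Γ^α_{jα} = -μ_j - (n+1) ν_j`, with the same contribution `(n+1) ξ_j`. Only the sign of `μ`
changes, which is why 2 and 2' can be exchanged. -/
theorem sum_coeffPi_right (hn : 0 < n) (hom : IsNormalProjectiveConnection nabla om)
    (he : e ∈ IsManifold.maximalAtlas (𝓡 n) ∞ M) {σ : Vec n → PCoord n}
    (hσ : IsLocalSection e σ) (ha : ∀ x ∈ e.target, (σ x).2.1 = delta) {x : Vec n}
    (hx : x ∈ e.target) (j : Fin n) :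
    ∑ i, coeffPi (om e) σ i j i x =
      -mu nabla e j x + (n + 1) * ((σ x).2.2 j - nu nabla e j x) := by
  have hn1 : (n : ℝ) + 1 ≠ 0 := by positivity
  simp only [coeffPi_eq hn hom he hσ ha hx, Finset.sum_add_distrib, ← Finset.sum_mul,
    sum_delta_self, sum_delta_mul, mu, nu]
  field_simp
  ring

/-- Under condition 1), each of the conditions 2) and 2') says that `ξ_j = ν_j`. -/
theorem cond2_iff (hn : 0 < n) (hom : IsNormalProjectiveConnection nabla om)
    (he : e ∈ IsManifold.maximalAtlas (𝓡 n) ∞ M) {σ : Vec n → PCoord n}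
    (hσ : IsLocalSection e σ) (ha : ∀ x ∈ e.target, (σ x).2.1 = delta) :
    Cond2 nabla (om e) e σ ↔ ∀ x ∈ e.target, ∀ k, (σ x).2.2 k = nu nabla e k x := by
  have hn1 : (n : ℝ) + 1 ≠ 0 := by positivity
  refine forall₃_congr fun x hx k => ?_
  rw [sum_coeffPi_left hn hom he hσ ha hx, add_eq_left, mul_eq_zero, sub_eq_zero,
    or_iff_right hn1]

theorem cond2'_iff (hn : 0 < n) (hom : IsNormalProjectiveConnection nabla om)
    (he : e ∈ IsManifold.maximalAtlas (𝓡 n) ∞ M) {σ : Vec n → PCoord n}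
    (hσ : IsLocalSection e σ) (ha : ∀ x ∈ e.target, (σ x).2.1 = delta) :
    Cond2' nabla (om e) e σ ↔ ∀ x ∈ e.target, ∀ k, (σ x).2.2 k = nu nabla e k x := by
  have hn1 : (n : ℝ) + 1 ≠ 0 := by positivity
  refine forall₃_congr fun x hx k => ?_
  rw [sum_coeffPi_right hn hom he hσ ha hx, add_eq_left, mul_eq_zero, sub_eq_zero,
    or_iff_right hn1]

/-- The section `x ↦ (x, δ^i_j, ν_j)` of `P`, in product coordinates. -/
noncomputable def normalSection (nabla : AffConn n M) (e : OpenPartialHomeomorph M (Vec n)) (x : Vec n) :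
    PCoord n :=
  (x, delta, fun j => nu nabla e j x)

theorem isLocalSection_normalSection (hn : 0 < n) (hom : IsNormalProjectiveConnection nabla om)
    (he : e ∈ IsManifold.maximalAtlas (𝓡 n) ∞ M) : IsLocalSection e (normalSection nabla e) where
  smooth := contDiffOn_id.prodMk
    (contDiffOn_const.prodMk (contDiffOn_pi.2 fun j => hom.contDiffOn_nu hn he j))
  mem := fun _ hx => ⟨hx, Inv_delta⟩
  base := fun _ _ => rfl

/-! ### The structure equation along the section. -/

theorem contDiffOn_coeffPi (hom : IsNormalProjectiveConnection nabla om)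
    (he : e ∈ IsManifold.maximalAtlas (𝓡 n) ∞ M) {σ : Vec n → PCoord n}
    (hσ : IsLocalSection e σ) (i j k : Fin n) :
    ContDiffOn ℝ ∞ (coeffPi (om e) σ i j k) e.target := by
  refine (c1 i j).contDiff.comp_contDiffOn (ContDiffOn.clm_apply
    ((hom.smooth e he).comp hσ.smooth hσ.mem) (ContDiffOn.clm_apply ?_ contDiffOn_const))
  exact hσ.smooth.fderiv_of_isOpen e.open_target le_rfl

/-- The structure equation pulled back by a section that satisfies condition 1). -/
theorem curvature_pullback (hom : IsNormalProjectiveConnection nabla om)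
    (he : e ∈ IsManifold.maximalAtlas (𝓡 n) ∞ M) {σ : Vec n → PCoord n}
    (hσ : IsLocalSection e σ) (h1 : Cond1 (om e) e σ) {x : Vec n} (hx : x ∈ e.target)
    (i j k l : Fin n) :
    curvature (om e) i j (σ x) (fderiv ℝ σ x (EuclideanSpace.single k 1))
        (fderiv ℝ σ x (EuclideanSpace.single l 1)) =
      pd k (coeffPi (om e) σ i j l) x - pd l (coeffPi (om e) σ i j k) x
        + ∑ m, (coeffPi (om e) σ i m k x * coeffPi (om e) σ m j l x
          - coeffPi (om e) σ i m l x * coeffPi (om e) σ m j k x)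
        + (delta i k * coeffP (om e) σ j l x - delta i l * coeffP (om e) σ j k x)
        - delta i j * (coeffP (om e) σ l k x - coeffP (om e) σ k l x) := by
  have hω : DifferentiableAt ℝ (fun u => (c1 i j).comp (om e u)) (σ x) :=
    (differentiableAt_const _).clm_comp
      (((hom.smooth e he).contDiffAt ((isOpen_pDomain e).mem_nhds (hσ.mem x hx))).differentiableAt
        (by simp))
  have h0 : ∀ i m, (c0 i) (om e (σ x) (fderiv ℝ σ x (EuclideanSpace.single m 1))) = delta i m := by
    intro i m
    refine (h1 x hx (EuclideanSpace.single m 1) i).trans ?_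
    simp [delta]
  have hw : ∑ m, (coeffP (om e) σ m k x * delta m l - coeffP (om e) σ m l x * delta m k) =
      coeffP (om e) σ l k x - coeffP (om e) σ k l x := by
    simp [Finset.sum_sub_distrib, delta]
  rw [curvature, dForm_pullback hω (hσ.contDiffAt hx), ← hw]
  simp only [wedge, ContinuousLinearMap.comp_apply, h0]
  rfl

/-- The contracted structure equation `n Π_{jl} - Π_{lj} = -R_{jl}`. -/
theorem trace_system (hom : IsNormalProjectiveConnection nabla om)
    (he : e ∈ IsManifold.maximalAtlas (𝓡 n) ∞ M) {σ : Vec n → PCoord n}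
    (hσ : IsLocalSection e σ) (h1 : Cond1 (om e) e σ)
    (h2' : Cond2' nabla (om e) e σ) {x : Vec n} (hx : x ∈ e.target) (j l : Fin n) :
    (n : ℝ) * coeffP (om e) σ j l x - coeffP (om e) σ l j x =
      -ricciTerm nabla (om e) e σ j l x := by
  obtain ⟨K, hK, hΩ, hR⟩ := hom.ricciFlat e he (σ x) (hσ.mem x hx)
  have h0 : ∀ i m, (c0 i) (om e (σ x) (fderiv ℝ σ x (EuclideanSpace.single m 1))) = delta i m := by
    intro i m
    refine (h1 x hx (EuclideanSpace.single m 1) i).trans ?_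
    simp [delta]
  -- Since `σ^*ω^k = dx^k`, evaluating on the images of coordinate vectors isolates single
  -- coefficients of `K`.
  have hKe : ∀ i, K i j i l =
      curvature (om e) i j (σ x) (fderiv ℝ σ x (EuclideanSpace.single i 1))
        (fderiv ℝ σ x (EuclideanSpace.single l 1)) := by
    intro i
    rw [hΩ]
    simp only [wedge, ContinuousLinearMap.comp_apply, h0]
    rw [← half_sum_delta_wedge (fun k l => hK i j k l) i l]
  -- Condition 2' holds on an open set, so it may be differentiated; this produces the term
  -- `∂μ_j/∂x^l`.
  have hpd : ∑ i, pd l (coeffPi (om e) σ i j i) x = -pd l (mu nabla e j) x := by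
    have hd : ∀ i ∈ Finset.univ, DifferentiableAt ℝ (coeffPi (om e) σ i j i) x := fun i _ =>
      ((contDiffOn_coeffPi hom he hσ i j i).contDiffAt
        (e.open_target.mem_nhds hx)).differentiableAt (by simp)
    have heq : (fun y => ∑ i, coeffPi (om e) σ i j i y) =ᶠ[nhds x] fun y => -mu nabla e j y :=
      Filter.eventually_of_mem (e.open_target.mem_nhds hx) fun y hy => h2' y hy j
    have h3 := heq.fderiv_eq (𝕜 := ℝ)
    rw [fderiv_fun_sum hd, fderiv_fun_neg] at h3
    simpa [pd] using congrArg (fun L => L (EuclideanSpace.single l 1)) h3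
  have hsum := hR j l
  simp only [hKe, curvature_pullback hom he hσ h1 hx, Finset.sum_sub_distrib,
    Finset.sum_add_distrib, hpd, ← Finset.sum_mul, sum_delta_self, sum_delta_mul] at hsum
  -- The second use of 2': the contracted factor `Π^i_{mi}` becomes `-μ_m`.
  have hq : ∑ i, ∑ m, coeffPi (om e) σ i m i x * coeffPi (om e) σ m j l x =
      -∑ m, mu nabla e m x * coeffPi (om e) σ m j l x := by
    rw [Finset.sum_comm, ← Finset.sum_neg_distrib]
    refine Finset.sum_congr rfl fun m _ => ?_
    rw [← Finset.sum_mul, h2' x hx m, neg_mul]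
  have hr : ∑ i, ∑ m, coeffPi (om e) σ i m l x * coeffPi (om e) σ m j i x =
      ∑ α, ∑ β, coeffPi (om e) σ α j β x * coeffPi (om e) σ β α l x := by
    rw [Finset.sum_comm]
    simp only [mul_comm]
  rw [hq, hr] at hsum
  rw [ricciTerm]
  linarith

end Connection

end ProjConn

/-! ### The proposition. -/

theorem mainTheorem4 {n : ℕ} (hn : 2 ≤ n) {M : Type*} [TopologicalSpace M] [T2Space M]
    [ChartedSpace (EuclideanSpace ℝ (Fin n)) M] [IsManifold (𝓡 n) ∞ M]
    (nabla : ProjConn.AffConn n M) (hnabla : CovariantDerivative.ContMDiffCovariantDerivative nabla ∞)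
    (om : OpenPartialHomeomorph M (EuclideanSpace ℝ (Fin n)) → ProjConn.GForm n)
    (hom : ProjConn.IsNormalProjectiveConnection nabla om)
    (e : OpenPartialHomeomorph M (EuclideanSpace ℝ (Fin n)))
    (he : e ∈ IsManifold.maximalAtlas (𝓡 n) ∞ M) :
    ∃ σ : EuclideanSpace ℝ (Fin n) → ProjConn.PCoord n,
      ProjConn.IsLocalSection e σ ∧
      ProjConn.Cond1 (om e) e σ ∧
      ProjConn.Cond2 nabla (om e) e σ ∧
      ProjConn.Cond2' nabla (om e) e σ ∧
      (∀ x ∈ e.target, ∀ i j k,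
        ProjConn.coeffPi (om e) σ i j k x =
          ProjConn.christoffel nabla e i j k x
            + ProjConn.delta i j * ProjConn.nu nabla e k x
            + ProjConn.delta i k * ProjConn.nu nabla e j x) ∧
      (∀ x ∈ e.target, ∀ i j k,
        ProjConn.coeffPi (om e) σ i j k x =
          ProjConn.christoffel nabla e i j k x
            - 1 / (2 * ((n : ℝ) + 1)) *
              (ProjConn.delta i j * (∑ α, ProjConn.christoffel nabla e α α k x
                  + ∑ α, ProjConn.christoffel nabla e α k α x)
                + ProjConn.delta i k * (∑ α, ProjConn.christoffel nabla e α α j x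
                  + ∑ α, ProjConn.christoffel nabla e α j α x))) ∧
      (∀ x ∈ e.target, ∀ j k,
        ProjConn.coeffP (om e) σ j k x =
          -1 / ((n : ℝ) ^ 2 - 1) *
            ((n : ℝ) * ProjConn.ricciTerm nabla (om e) e σ j k x
              + ProjConn.ricciTerm nabla (om e) e σ k j x)) ∧
      (∀ σ' : EuclideanSpace ℝ (Fin n) → ProjConn.PCoord n,
        ProjConn.IsLocalSection e σ' → ProjConn.Cond1 (om e) e σ' →
        (ProjConn.Cond2 nabla (om e) e σ' ∨ ProjConn.Cond2' nabla (om e) e σ') →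
        Set.EqOn σ' σ e.target) := by
  have hn0 : 0 < n := by omega
  have hσ := ProjConn.isLocalSection_normalSection hn0 hom he
  have ha : ∀ x ∈ e.target, (ProjConn.normalSection nabla e x).2.1 = ProjConn.delta :=
    fun _ _ => rfl
  have h1 := (ProjConn.cond1_iff hn0 hom he hσ).2 ha
  have h2 := (ProjConn.cond2_iff hn0 hom he hσ ha).2 fun _ _ _ => rfl
  have h2' := (ProjConn.cond2'_iff hn0 hom he hσ ha).2 fun _ _ _ => rfl
  refine ⟨_, hσ, h1, h2, h2', fun _ hx => ProjConn.coeffPi_eq hn0 hom he hσ ha hx, fun x hx i j k => ?_, fun x hx j k => ?_,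
    fun σ' hσ' h1' hor x hx => ?_⟩
  · rw [ProjConn.coeffPi_eq hn0 hom he hσ ha hx]
    simp only [ProjConn.normalSection, ProjConn.nu]
    ring
  · exact ProjConn.eq_of_trace_system hn (P := fun j k => ProjConn.coeffP (om e) _ j k x)
      (R := fun j k => ProjConn.ricciTerm nabla (om e) e _ j k x)
      (fun j k => ProjConn.trace_system hom he hσ h1 h2' hx j k) j k
  -- All three product coordinates of `σ'` are forced: `x` as a section, `a = δ` by 1, and `ξ = ν`
  -- by either 2 or 2'.
  · have ha' := (ProjConn.cond1_iff hn0 hom he hσ').1 h1'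
    have hξ := hor.elim (ProjConn.cond2_iff hn0 hom he hσ' ha').1
      (ProjConn.cond2'_iff hn0 hom he hσ' ha').1
    exact Prod.ext (hσ'.base x hx) (Prod.ext (ha' x hx) (funext (hξ x hx)))
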